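/- Let $n\geq 3$ be an odd integer, let $q$ be a power of $2$, and let $V$ be a vector space of dimension $n$ over the finite field $\mathbb{F}_q$. The rank of a bilinear form $f:V\times V\to\mathbb{F}_q$ is $\dim V-\dim\{u\in V: f(u,v)=0 \text{ for all } v\in V\}$. For an integer $r$ with $1\leq r\leq n$, a constant rank $r$ subspace is a non-zero subspace of the space of bilinear forms on $V\times V$, all of whose non-zero elements have rank exactly $r$. Let $\mathcal{M}$ be a $2n$-dimensional subspace of the space $\mathrm{Symm}(V)$ of symmetric bilinear forms on $V\times V$ in which each non-zero element has rank at least $n-2$, and let $\mathcal{M}_{\mathrm{Alt}}$ be the subspace of all $f\in\mathcal{M}$ that are alternating, that is, satisfy $f(v,v)=0$ for all $v\in V$. Then $\mathcal{M}_{\mathrm{Alt}}$ is an $n$-dimensional constant rank $n-1$ subspace. Furthermore, if $q\geq n-1$, then every constant rank $n-2$ subspace of $\mathcal{M}$ has dimension at most $(2n-3)/3$. -/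

import Mathlib

namespace FormSpace

section

variable (K V : Type*) [Field K] [AddCommGroup V] [Module K V]

/-- The subspace of symmetric bilinear forms on `V × V`. -/
def symm : Submodule K (LinearMap.BilinForm K V) where
  carrier := {f | f.IsSymm}
  zero_mem' := ⟨fun _ _ => rfl⟩
  add_mem' hf hg := hf.add hg
  smul_mem' c _ hf := hf.smul c

/-- The subspace of alternating bilinear forms on `V × V`. -/
def alt : Submodule K (LinearMap.BilinForm K V) where
  carrier := {f | f.IsAlt}
  zero_mem' := fun _ => rfl
  add_mem' hf hg := hf.add hg
  smul_mem' c _ hf := hf.smul c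

end

section

variable {K V : Type*} [Field K] [AddCommGroup V] [Module K V]

/-- The left radical: all `u` with `f u v = 0` for every `v`. -/
def radL (f : LinearMap.BilinForm K V) : Submodule K V := LinearMap.ker f

theorem mem_radL (f : LinearMap.BilinForm K V) (u : V) : u ∈ radL f ↔ ∀ v, f u v = 0 := by
  simp [radL, LinearMap.ext_iff]

/-- The rank of a bilinear form: `dim V - dim rad_L f`. For finite-dimensional `V` the
natural-number subtraction does not truncate. -/
noncomputable def rank (f : LinearMap.BilinForm K V) : ℕ :=
  Module.finrank K V - Module.finrank K (radL f)

/-- The subspace of alternating forms contained in `M`. -/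
def altPart (M : Submodule K (LinearMap.BilinForm K V)) :
    Submodule K (LinearMap.BilinForm K V) :=
  M ⊓ alt K V

/-- A constant rank `r` subspace: a non-zero subspace, all of whose non-zero elements have
rank `r`, where `1 ≤ r ≤ dim V`. -/
structure IsConstantRank (N : Submodule K (LinearMap.BilinForm K V)) (r : ℕ) : Prop where
  ne_bot : N ≠ ⊥
  one_le : 1 ≤ r
  le_dim : r ≤ Module.finrank K V
  rank_eq : ∀ f ∈ N, f ≠ 0 → rank f = r

end

end FormSpace

/-! Write `n = dim V`. In characteristic two `v ↦ √(f v v)` is linear in `v` and additive in `f`,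
and it vanishes exactly when `f` is alternating. So the alternating part of `M` has dimension at
least `2n - n = n`. Alternating forms have even rank, hence rank `n - 1` here, and counting pairs
(form, vector in its radical) excludes any larger dimension (`natCard_eq_of_finrank_radL_eq_one`).

For the second claim, the key is that any two independent vectors lie together in the radicals of
exactly one line of forms of `M` (`natCard_inf_radAt_pair`). Dimension count gives at least a line.
An upper bound on the total size of all radicals and a lower bound on that of the even-rank ones
(`sum_even_rank_ge`) show that the average is no larger.

A constant rank `n - 2` subspace `N` has planes as radicals, and contains no non-zero alternating
form because `n - 2` is odd. When `q > n - 2`, an eigenvalue argument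
(`apply_self_eq_zero_of_mem_radL`) puts all these planes in the space `U` of vectors isotropic for
every form of `N`, and `dim N + dim U ≤ n`. Thus `N` has at most as many lines as `U` has planes,
which yields the bound (`three_mul_add_three_le`). -/

namespace FormSpace

open Module

/-! ### Counting tools over a finite field -/

section Counting

theorem sum_natCard_comm {α β : Type*} [Fintype α] [Fintype β] (r : α → β → Prop) :
    ∑ a, Nat.card {b // r a b} = ∑ b, Nat.card {a // r a b} := by
  rw [← Nat.card_sigma, ← Nat.card_sigma]
  exact Nat.card_congr
    { toFun := fun x => ⟨x.2.1, x.1, x.2.2⟩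
      invFun := fun x => ⟨x.2.1, x.1, x.2.2⟩
      left_inv := fun _ => rfl
      right_inv := fun _ => rfl }

/-- If the kernel of an additive map embeds in `Z` and its range lies in `T`, then the domain has
at most `|Z| * |T|` elements. -/
theorem natCard_le_mul_of_addMonoidHom {X Y W : Type*} [AddGroup X] [AddGroup Y] [Finite Y]
    [Finite W] (φ : X →+ Y) (T : Set Y) (hT : ∀ x, φ x ∈ T) (Z : Set W) (e : X → W)
    (he : Function.Injective e) (hZ : ∀ x, φ x = 0 → e x ∈ Z) :
    Nat.card X ≤ Nat.card Z * Nat.card T := by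
  rw [← φ.ker.card_mul_index, AddSubgroup.index_ker]
  refine Nat.mul_le_mul ?_ ?_
  · exact Nat.card_le_card_of_injective (fun x : φ.ker => (⟨e x, hZ x x.2⟩ : Z))
      fun a b h => Subtype.ext (he (congrArg Subtype.val h))
  · exact Nat.card_le_card_of_injective (fun x : φ.range => (⟨x, by
      obtain ⟨_, y, rfl⟩ := x; exact hT y⟩ : T)) fun a b h => Subtype.ext (Subtype.mk.inj h)

variable {K V : Type*} [Field K] [AddCommGroup V] [Module K V] [FiniteDimensional K V]

/-- The number of linearly independent pairs in a subspace. -/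
theorem natCard_linearIndependent_pairs [Finite K] (U : Submodule K V) :
    Nat.card {s : {s : Fin 2 → V // LinearIndependent K s} // ∀ i, s.1 i ∈ U} =
      (Nat.card K ^ finrank K U - 1) * (Nat.card K ^ finrank K U - Nat.card K) := by
  have : Fintype K := Fintype.ofFinite K
  have : Finite V := Module.finite_of_finite K
  have e : {s : {s : Fin 2 → V // LinearIndependent K s} // ∀ i, s.1 i ∈ U} ≃
      {s : Fin 2 → U // LinearIndependent K s} :=
    { toFun := fun s => ⟨fun i => ⟨s.1.1 i, s.2 i⟩, by
        have h : LinearIndependent K (U.subtype ∘ fun i => (⟨s.1.1 i, s.2 i⟩ : U)) := s.1.2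
        exact h.of_comp⟩
      invFun := fun s => ⟨⟨fun i => s.1 i, s.2.map' U.subtype U.ker_subtype⟩, fun i => (s.1 i).2⟩
      left_inv := fun _ => rfl
      right_inv := fun _ => rfl }
  rw [Nat.card_congr e]
  by_cases h : 2 ≤ finrank K U
  · rw [card_linearIndependent h]
    simp [Fin.prod_univ_two]
  · have : IsEmpty {s : Fin 2 → U // LinearIndependent K s} :=
      ⟨fun s => h (by simpa using s.2.fintype_card_le_finrank)⟩
    rw [Nat.card_of_isEmpty]
    interval_cases finrank K U <;> simp

theorem natCard_dualAnnihilator (U : Submodule K V) :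
    Nat.card U.dualAnnihilator * Nat.card K ^ finrank K U = Nat.card K ^ finrank K V := by
  rw [Module.natCard_eq_pow_finrank (K := K) (V := U.dualAnnihilator), ← pow_add, add_comm,
    Subspace.finrank_add_finrank_dualAnnihilator_eq]

theorem natCard_setOf_apply_eq_zero [Finite K] {u : V} (hu : u ≠ 0) :
    Nat.card {φ : Dual K V | φ u = 0} = Nat.card K ^ (finrank K V - 1) := by
  have h := natCard_dualAnnihilator (K := K) (Submodule.span K {u})
  have h1 : finrank K (Submodule.span K {u}) = 1 := finrank_span_singleton hu
  have h2 : 1 ≤ finrank K V := h1 ▸ Submodule.finrank_le _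
  have h3 : {φ : Dual K V | φ u = 0} = (Submodule.span K {u}).dualAnnihilator := by
    ext φ
    simp
  rw [h3]
  rw [h1, pow_one, ← Nat.sub_add_cancel h2, pow_succ] at h
  exact Nat.eq_of_mul_eq_mul_right Nat.card_pos h

end Counting

/-! ### Ranks and radicals of bilinear forms -/

section Forms

variable {K V : Type*} [Field K] [AddCommGroup V] [Module K V]

variable [FiniteDimensional K V]

theorem rank_add_finrank_radL (f : LinearMap.BilinForm K V) :
    rank f + finrank K (radL f) = finrank K V :=
  Nat.sub_add_cancel (Submodule.finrank_le _)

/-- A maximal totally isotropic `W` is its own orthogonal, so `2 dim W = dim V + dim rad f = rank f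
+ 2 dim rad f`. -/
theorem even_rank_of_isAlt {f : LinearMap.BilinForm K V} (hf : f.IsAlt) : Even (rank f) := by
  obtain ⟨W, hW, hmax⟩ := exists_maximal_of_wellFoundedGT
    (fun W : Submodule K V => W ≤ f.orthogonal W) ⟨⊥, bot_le⟩
  have hself : f.orthogonal W ≤ W := by
    intro z hz
    have hz' : ∀ w ∈ W, f w z = 0 := hz
    have hz'' : ∀ w ∈ W, f z w = 0 := fun w hw => hf.isRefl _ _ (hz' w hw)
    have h := hmax (y := W ⊔ Submodule.span K {z}) (by
      intro x hx y hy
      obtain ⟨x1, hx1, x2, hx2, rfl⟩ := Submodule.mem_sup.1 hx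
      obtain ⟨y1, hy1, y2, hy2, rfl⟩ := Submodule.mem_sup.1 hy
      obtain ⟨a, rfl⟩ := Submodule.mem_span_singleton.1 hx2
      obtain ⟨b, rfl⟩ := Submodule.mem_span_singleton.1 hy2
      have h1 : f y1 x1 = 0 := hW hx1 y1 hy1
      have h2 : f z z = 0 := hf z
      simp [h1, h2, hz' _ hy1, hz'' _ hx1]) le_sup_left
    exact h (Submodule.mem_sup_right (Submodule.mem_span_singleton_self z))
  have heq : f.orthogonal W = W := le_antisymm hself hW
  have hrad : W ⊓ LinearMap.ker f = LinearMap.ker f := by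
    refine inf_eq_right.2 fun x hx => hself fun w _ => ?_
    have hx' : f x w = 0 := by rw [LinearMap.mem_ker.1 hx]; rfl
    exact hf.isRefl _ _ hx'
  have h := LinearMap.BilinForm.finrank_add_finrank_orthogonal' (B := f) W
  have h2 := rank_add_finrank_radL f
  rw [heq, hrad] at h
  rw [radL] at h2
  exact (Nat.even_iff.2 (by omega))

/-- In a constant rank `r` space of symmetric forms over a field with more than `r` elements, every
form vanishes on the radical of each non-zero form. -/
theorem apply_self_eq_zero_of_mem_radL [Finite K] {N : Submodule K (LinearMap.BilinForm K V)}
    (hsymm : N ≤ symm K V) {r : ℕ} (hN : ∀ f ∈ N, f ≠ 0 → rank f = r) (hr : r < Nat.card K)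
    {f g : LinearMap.BilinForm K V} (hf : f ∈ N) (hf0 : f ≠ 0) (hg : g ∈ N) {u : V}
    (hu : u ∈ radL f) : g u u = 0 := by
  by_contra hc
  have hfu : ∀ v, f u v = 0 := (mem_radL f u).1 hu
  have hfs : ∀ x y, f x y = f y x := (hsymm hf).eq
  have hgs : ∀ x y, g x y = g y x := (hsymm hg).eq
  have hgu : g u ≠ 0 := fun h => hc (by rw [h]; rfl)
  -- `H` is the hyperplane `g`-orthogonal to `u`. It misses `u`, so `R = rad f ∩ H` is smaller than
  -- `rad f`. On a complement `C` of `R` in `H` the form `f` is nondegenerate, and `dim C ≤ r`.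
  set H := LinearMap.ker (g u) with hH
  have hHdim : finrank K H + 1 = finrank K V := Module.Dual.finrank_ker_add_one_of_ne_zero hgu
  set R := (radL f).comap H.subtype with hR
  obtain ⟨C, hC⟩ := R.exists_isCompl
  have hRC := Submodule.finrank_add_eq_of_isCompl hC
  have hRlt : finrank K R < finrank K (radL f) := by
    rw [← Submodule.finrank_map_subtype_eq H R]
    refine Submodule.finrank_lt_finrank_of_lt (lt_of_le_of_ne (Submodule.map_comap_le _ _) ?_)
    intro h
    obtain ⟨x, -, hx⟩ := h.ge hu
    have hx' : (x : V) = u := hx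
    have := LinearMap.mem_ker.1 x.2
    exact hc (by rwa [hx'] at this)
  let ι : C →ₗ[K] V := H.subtype ∘ₗ C.subtype
  have hι : Function.Injective ι := H.subtype_injective.comp C.subtype_injective
  have hιf : ∀ x : C, ι x ∈ radL f → x = 0 := by
    intro x hx
    have : (x : H) ∈ R ⊓ C := ⟨hx, x.2⟩
    rw [hC.inf_eq_bot] at this
    exact Subtype.ext this
  have hCr : finrank K C ≤ r := by
    have h1 : Disjoint (LinearMap.range ι) (radL f) := by
      rw [Submodule.disjoint_def]
      rintro _ ⟨x, rfl⟩ hx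
      rw [hιf x hx, map_zero]
    have h2 := Submodule.finrank_add_finrank_le_of_disjoint h1
    rw [LinearMap.finrank_range_of_inj hι] at h2
    have := rank_add_finrank_radL f
    rw [hN f hf hf0] at this
    omega
  let fC : C →ₗ[K] Dual K C := f.compl₁₂ ι ι
  have hfC : Function.Injective fC := by
    rw [← LinearMap.ker_eq_bot, LinearMap.ker_eq_bot']
    intro x hx
    refine hιf x ((mem_radL f _).2 fun v => ?_)
    have hv : v - (g u v / g u u) • u ∈ H := by
      simp [hH, div_mul_cancel₀ _ hc]
    have htop : (⟨_, hv⟩ : H) ∈ R ⊔ C := by rw [hC.sup_eq_top]; trivial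
    obtain ⟨ρ, hρ, γ, hγ, h⟩ := Submodule.mem_sup.1 htop
    have h' : v = ρ + γ + (g u v / g u u) • u := by
      have := congrArg Subtype.val h
      simp only [Submodule.coe_add] at this
      rw [this]; abel
    have h1 : f ρ (ι x) = 0 := (mem_radL f _).1 hρ _
    have h2 : f (ι x) γ = 0 := LinearMap.congr_fun hx ⟨γ, hγ⟩
    rw [h', map_add, map_add, map_smul, hfs (ι x) ρ, hfs (ι x) u, h1, h2, hfu]
    simp
  let e : C ≃ₗ[K] Dual K C := LinearEquiv.ofInjectiveOfFinrankEq fC hfC (by simp)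
  have he : ∀ x, e x = fC x :=
    LinearMap.congr_fun (LinearEquiv.coe_ofInjectiveOfFinrankEq fC hfC (by simp))
  -- `T` is `f⁻¹ g` on `C`. For each scalar `s`, the radical of `g - s f` lies in `H` (pair with
  -- `u`) and is larger than `R`, so it meets `C` in an eigenvector for `s`. That gives more than `r
  -- ≥ dim C` eigenvalues.
  let T : Module.End K C := e.symm.toLinearMap ∘ₗ (g.compl₁₂ ι ι)
  have hT : ∀ s : K, ∃ x : C, T.HasEigenvector s x := by
    intro s
    have hne : g + (-s) • f ≠ 0 := by
      intro h
      have : (g + (-s) • f) u u = 0 := by rw [h]; rfl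
      simp [hfu] at this
      exact hc this
    have hmem : g + (-s) • f ∈ N := N.add_mem hg (N.smul_mem _ hf)
    have hle : radL (g + (-s) • f) ≤ H := by
      intro x hx
      have := (mem_radL _ _).1 hx u
      simpa [hfs x u, hfu, hgs x u, hH] using this
    have hd : finrank K ((radL (g + (-s) • f)).comap H.subtype) = finrank K (radL f) := by
      have h1 := rank_add_finrank_radL f
      have h2 := rank_add_finrank_radL (g + (-s) • f)
      rw [hN _ hmem hne] at h2
      rw [hN _ hf hf0] at h1
      rw [LinearEquiv.finrank_eq (Submodule.comapSubtypeEquivOfLe hle)]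
      omega
    have hnd : ¬ Disjoint ((radL (g + (-s) • f)).comap H.subtype) C := by
      intro h
      have := Submodule.finrank_add_finrank_le_of_disjoint h
      omega
    rw [Submodule.disjoint_def] at hnd
    push Not at hnd
    obtain ⟨x, hx, hxC, hx0⟩ := hnd
    refine ⟨⟨x, hxC⟩, Module.End.mem_eigenspace_iff.2 ?_, fun h => hx0 (congrArg Subtype.val h)⟩
    apply e.injective
    ext y
    have := (mem_radL _ _).1 hx (ι y)
    simp only [T, LinearMap.comp_apply, LinearEquiv.coe_coe, LinearEquiv.apply_symm_apply, map_smul]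
    simp [← sub_eq_add_neg, sub_eq_zero] at this
    simpa [he, fC, ι] using this
  choose x hx using hT
  have : Fintype K := Fintype.ofFinite K
  have h1 := (Module.End.eigenvectors_linearIndependent' T id Function.injective_id x
    hx).fintype_card_le_finrank
  rw [← Nat.card_eq_fintype_card] at h1
  omega

end Forms
end FormSpace

namespace FormSpace

open Module

variable {K V : Type*} [Field K] [AddCommGroup V] [Module K V]

noncomputable instance addCommGroupSubmodule (M : Submodule K (LinearMap.BilinForm K V)) :
    AddCommGroup M :=
  Module.addCommMonoidToAddCommGroup K

variable (K) in
/-- The forms having the vector `u` in their left radical. -/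
def radAt (u : V) : Submodule K (LinearMap.BilinForm K V) := LinearMap.ker (LinearMap.applyₗ u)

theorem mem_radAt {f : LinearMap.BilinForm K V} {u : V} : f ∈ radAt K u ↔ u ∈ radL f := Iff.rfl

theorem apply_eq_zero_of_mem_radAt {f : LinearMap.BilinForm K V} {u : V} (h : f ∈ radAt K u)
    (v : V) : f u v = 0 := (mem_radL f u).1 h v

/-! ### The square root of the diagonal -/

section SqrtDiag

variable [Finite K] [CharP K 2]

/-- The linear form `v ↦ √(f v v)` of a symmetric form `f` in characteristic two. -/
noncomputable def sqrtDiag : symm K V →+ Dual K V where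
  toFun f :=
    { toFun := fun v => (frobeniusEquiv K 2).symm (f.1 v v)
      map_add' := fun v w => by
        rw [← map_add]
        congr 1
        simp only [map_add, LinearMap.add_apply]
        rw [show f.1 w v = f.1 v w from f.2.eq w v, add_assoc, ← add_assoc (f.1 v w),
          CharTwo.add_self_eq_zero, zero_add]
      map_smul' := fun c v => by
        apply (frobeniusEquiv K 2).injective
        simp [frobenius_def, mul_pow]
        ring }
  map_zero' := by ext; simp
  map_add' f g := by ext; simp

theorem sqrtDiag_sq (f : symm K V) (v : V) : sqrtDiag f v ^ 2 = f.1 v v :=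
  frobeniusEquiv_symm_pow_p K 2 _

theorem sqrtDiag_apply_eq_zero_iff (f : symm K V) (v : V) : sqrtDiag f v = 0 ↔ f.1 v v = 0 := by
  rw [← sqrtDiag_sq, sq_eq_zero_iff]

theorem mem_alt_of_sqrtDiag_eq_zero {f : symm K V} (h : sqrtDiag f = 0) : f.1 ∈ alt K V :=
  fun v => (sqrtDiag_apply_eq_zero_iff f v).1 (by rw [h]; rfl)

/-- Adding the tensor square of `sqrtDiag f` makes `f` alternating. The hypotheses on `y` ensure
that the radical is unchanged: pairing a radical vector `x` of the new form with `y` gives `sqrtDiag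
f x = 0`. -/
theorem even_rank_of_apply_eq_sqrtDiag [FiniteDimensional K V] (f : symm K V) {y : V}
    (hy : f.1 y y = 0) (h : f.1 y = sqrtDiag f) : Even (rank f.1) := by
  have hB : (f.1 + (sqrtDiag f).smulRight (sqrtDiag f)).IsAlt := fun v => by
    simp [← sq, sqrtDiag_sq, CharTwo.add_self_eq_zero]
  have hy' : sqrtDiag f y = 0 := (sqrtDiag_apply_eq_zero_iff f y).2 hy
  have hrad : radL (f.1 + (sqrtDiag f).smulRight (sqrtDiag f)) = radL f.1 := by
    ext x
    simp only [mem_radL, LinearMap.add_apply, LinearMap.smulRight_apply, LinearMap.smul_apply,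
      smul_eq_mul]
    constructor
    · intro hx
      have h1 := hx y
      rw [hy', mul_zero, add_zero, f.2.eq x y, h] at h1
      simpa [h1] using hx
    · intro hx v
      rw [(sqrtDiag_apply_eq_zero_iff f x).2 (hx x), hx v]
      simp
  have := even_rank_of_isAlt hB
  rwa [rank, hrad] at this

end SqrtDiag

/-! ### Double counts of forms against radical vectors -/

section

variable [Finite K] [FiniteDimensional K V]

omit [Finite K] [FiniteDimensional K V] in
theorem radL_zero : radL (0 : LinearMap.BilinForm K V) = ⊤ := LinearMap.ker_zero

omit [Finite K] [FiniteDimensional K V] in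
/-- Double counting of the pairs `(f, u)` with `u` in the radical of `f`. -/
theorem sum_natCard_radL [Fintype V] [DecidableEq V]
    (M : Submodule K (LinearMap.BilinForm K V)) [Fintype M] [DecidableEq M] :
    Nat.card V + ∑ f ∈ Finset.univ.erase (0 : M), Nat.card (radL f.1) =
      Nat.card M + ∑ u ∈ Finset.univ.erase (0 : V), Nat.card ↥(M ⊓ radAt K u) := by
  have h := sum_natCard_comm (fun (f : M) (u : V) => u ∈ radL f.1)
  have h1 : ∀ u : V, Nat.card {f : M // u ∈ radL f.1} = Nat.card ↥(M ⊓ radAt K u) := fun u =>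
    Nat.card_congr (Equiv.subtypeSubtypeEquivSubtypeInter (fun f => f ∈ M) fun f => u ∈ radL f)
  simp only [h1] at h
  rw [← Finset.add_sum_erase _ _ (Finset.mem_univ (0 : M)),
    ← Finset.add_sum_erase _ _ (Finset.mem_univ (0 : V))] at h
  have h2 : Nat.card {u : V // u ∈ radL (0 : M).1} = Nat.card V :=
    Nat.card_congr (Equiv.subtypeUnivEquiv fun u => by simp [mem_radL])
  have h3 : M ⊓ radAt K (0 : V) = M := inf_eq_left.2 fun f _ => by simp [mem_radAt]
  rw [h2, h3] at h
  exact h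

/-- Double counting of the pairs `(f, s)` with `s` a linearly independent pair of vectors in the
radical of `f`. -/
theorem sum_natCard_pairs (M : Submodule K (LinearMap.BilinForm K V)) [Fintype M]
    [DecidableEq M]
    [Fintype {s : Fin 2 → V // LinearIndependent K s}] :
    Nat.card {s : Fin 2 → V // LinearIndependent K s} + ∑ f ∈ Finset.univ.erase (0 : M),
      (Nat.card (radL f.1) - 1) * (Nat.card (radL f.1) - Nat.card K) =
      ∑ s : {s : Fin 2 → V // LinearIndependent K s},
        Nat.card ↥(M ⊓ radAt K (s.1 0) ⊓ radAt K (s.1 1)) := by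
  have h := sum_natCard_comm
    (fun (f : M) (s : {s : Fin 2 → V // LinearIndependent K s}) => ∀ i, s.1 i ∈ radL f.1)
  have h1 : ∀ s : {s : Fin 2 → V // LinearIndependent K s},
      Nat.card {f : M // ∀ i, s.1 i ∈ radL f.1} =
      Nat.card ↥(M ⊓ radAt K (s.1 0) ⊓ radAt K (s.1 1)) := fun s =>
    Nat.card_congr ((Equiv.subtypeSubtypeEquivSubtypeInter (fun f => f ∈ M)
      fun f => ∀ i, s.1 i ∈ radL f).trans (Equiv.subtypeEquivRight fun f => by
        simp [Fin.forall_fin_two, mem_radAt, and_assoc]))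
  simp only [h1] at h
  rw [← Finset.add_sum_erase _ _ (Finset.mem_univ (0 : M))] at h
  have h2 : Nat.card {s : {s : Fin 2 → V // LinearIndependent K s} //
      ∀ i, s.1 i ∈ radL (0 : M).1} = Nat.card {s : Fin 2 → V // LinearIndependent K s} :=
    Nat.card_congr (Equiv.subtypeUnivEquiv fun u => by simp [mem_radL])
  rw [h2] at h
  rw [← h]
  congr 1
  refine Finset.sum_congr rfl fun f _ => ?_
  rw [natCard_linearIndependent_pairs, Module.natCard_eq_pow_finrank (K := K) (V := radL f.1)]

end

/-! ### Lower and upper bounds for fibres -/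

section

variable [Finite K] [CharP K 2] [FiniteDimensional K V] {M : Submodule K (LinearMap.BilinForm K V)}

omit [CharP K 2] in
/-- Passing to the forms with `u` in the radical loses at most a factor `|V|`. -/
theorem natCard_le_natCard_inf_radAt_mul (u : V) :
    Nat.card M ≤ Nat.card ↥(M ⊓ radAt K u) * Nat.card K ^ finrank K V := by
  have : Finite V := Module.finite_of_finite K
  have : Finite (Dual K V) := Module.finite_of_finite K
  have : Finite (LinearMap.BilinForm K V) := Module.finite_of_finite K
  have h := natCard_le_mul_of_addMonoidHom
    ((LinearMap.applyₗ u ∘ₗ M.subtype : M →ₗ[K] Dual K V) : M →+ Dual K V) Set.univ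
    (fun _ => trivial) ((M ⊓ radAt K u : Submodule K _) : Set (LinearMap.BilinForm K V))
    Subtype.val Subtype.val_injective fun x hx => ⟨x.2, hx⟩
  rwa [Nat.card_univ, Module.natCard_eq_pow_finrank (K := K) (V := Dual K V),
    Subspace.dual_finrank_eq] at h

omit [CharP K 2] in
-- The functionals `f w` all kill `u`, which saves a factor `q` over the general bound.
theorem natCard_le_natCard_inf_radAt_mul_of_forall {u w : V} (hu : u ≠ 0)
    (h0 : ∀ f ∈ M, f w u = 0) :
    Nat.card M ≤ Nat.card ↥(M ⊓ radAt K w) * Nat.card K ^ (finrank K V - 1) := by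
  have : Finite (Dual K V) := Module.finite_of_finite K
  have : Finite (LinearMap.BilinForm K V) := Module.finite_of_finite K
  rw [← natCard_setOf_apply_eq_zero hu]
  exact natCard_le_mul_of_addMonoidHom
    ((LinearMap.applyₗ w ∘ₗ M.subtype : M →ₗ[K] Dual K V) : M →+ Dual K V) _
    (fun f => h0 f f.2) ((M ⊓ radAt K w : Submodule K _) : Set (LinearMap.BilinForm K V))
    Subtype.val Subtype.val_injective fun x hx => ⟨x.2, hx⟩

theorem natCard_le_natCard_altPart_mul (hs : M ≤ symm K V) :
    Nat.card M ≤ Nat.card (altPart M) * Nat.card K ^ finrank K V := by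
  have : Finite (Dual K V) := Module.finite_of_finite K
  have : Finite (LinearMap.BilinForm K V) := Module.finite_of_finite K
  have h := natCard_le_mul_of_addMonoidHom
    (sqrtDiag.comp (Submodule.inclusion hs : M →+ symm K V)) Set.univ
    (fun _ => trivial) (altPart M : Set (LinearMap.BilinForm K V))
    Subtype.val Subtype.val_injective fun x hx => ⟨x.2, mem_alt_of_sqrtDiag_eq_zero hx⟩
  rwa [Nat.card_univ, Module.natCard_eq_pow_finrank (K := K) (V := Dual K V),
    Subspace.dual_finrank_eq] at h

/-- If `u` is in the radical of `f`, then `sqrtDiag f` kills `u`, so `sqrtDiag` takes at most `q ^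
(n - 1)` values here. -/
theorem natCard_inf_radAt_le (hs : M ≤ symm K V) {u : V} (hu : u ≠ 0) :
    Nat.card ↥(M ⊓ radAt K u) ≤
      Nat.card ↥(altPart M ⊓ radAt K u) * Nat.card K ^ (finrank K V - 1) := by
  have : Finite (Dual K V) := Module.finite_of_finite K
  have : Finite (LinearMap.BilinForm K V) := Module.finite_of_finite K
  have hs' : M ⊓ radAt K u ≤ symm K V := inf_le_left.trans hs
  rw [← natCard_setOf_apply_eq_zero hu]
  exact natCard_le_mul_of_addMonoidHom
    (sqrtDiag.comp (Submodule.inclusion hs' : ↥(M ⊓ radAt K u) →+ symm K V)) _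
    (fun f => (sqrtDiag_apply_eq_zero_iff _ _).2 (apply_eq_zero_of_mem_radAt f.2.2 u))
    ((altPart M ⊓ radAt K u : Submodule K _) : Set (LinearMap.BilinForm K V))
    Subtype.val Subtype.val_injective
    fun x hx => ⟨⟨x.2.1, mem_alt_of_sqrtDiag_eq_zero (f := ⟨x.1, hs x.2.1⟩) hx⟩, x.2.2⟩

/-- The forms `f ∈ M` with `f y = √diag f` and `f y y = 0` are many. -/
theorem natCard_le_natCard_apply_eq_sqrtDiag_mul (hs : M ≤ symm K V) (hV : 0 < finrank K V)
    (y : V) :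
    Nat.card M ≤ Nat.card {f : M // f.1 y y = 0 ∧ f.1 y = sqrtDiag ⟨f.1, hs f.2⟩} *
      Nat.card K ^ finrank K V := by
  have : Finite (Dual K V) := Module.finite_of_finite K
  have : Finite (LinearMap.BilinForm K V) := Module.finite_of_finite K
  rcases eq_or_ne y 0 with rfl | hy
  · have h := natCard_le_mul_of_addMonoidHom
      (sqrtDiag.comp (Submodule.inclusion hs : M →+ symm K V)) Set.univ (fun _ => trivial)
      {f : M | f.1 0 0 = 0 ∧ f.1 0 = sqrtDiag ⟨f.1, hs f.2⟩} id Function.injective_id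
      fun x hx => ⟨by simp, by rw [map_zero]; exact hx.symm⟩
    rwa [Nat.card_univ, Module.natCard_eq_pow_finrank (K := K) (V := Dual K V),
      Subspace.dual_finrank_eq] at h
  -- Requiring `f y y = 0` costs a factor `q`. After that `f y - sqrtDiag f` kills `y`, so its
  -- vanishing costs only `q ^ (n - 1)`.
  · let ev : M →ₗ[K] K := LinearMap.applyₗ y ∘ₗ LinearMap.applyₗ y ∘ₗ M.subtype
    have h1 := natCard_le_mul_of_addMonoidHom (ev : M →+ K) Set.univ (fun _ => trivial)
      (LinearMap.ker ev : Set M) id Function.injective_id fun x hx => hx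
    let i : LinearMap.ker ev →+ symm K V :=
      (Submodule.inclusion hs ∘ₗ (LinearMap.ker ev).subtype : _ →ₗ[K] symm K V)
    let r : LinearMap.ker ev →+ Dual K V :=
      (LinearMap.applyₗ y ∘ₗ M.subtype ∘ₗ (LinearMap.ker ev).subtype : _ →ₗ[K] Dual K V)
    have h2 := natCard_le_mul_of_addMonoidHom (r - sqrtDiag.comp i) {φ : Dual K V | φ y = 0}
      (fun f => by
        have hf : f.1.1 y y = 0 := f.2
        have : sqrtDiag (i f) y = 0 := (sqrtDiag_apply_eq_zero_iff _ _).2 hf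
        have hr : r f y = 0 := hf
        simp [this, hr])
      {f : M | f.1 y y = 0 ∧ f.1 y = sqrtDiag ⟨f.1, hs f.2⟩} Subtype.val Subtype.val_injective
      fun x hx => ⟨x.2, sub_eq_zero.1 hx⟩
    rw [natCard_setOf_apply_eq_zero hy] at h2
    rw [Nat.card_univ] at h1
    obtain ⟨m, hm⟩ := Nat.exists_eq_succ_of_ne_zero hV.ne'
    rw [hm] at h2 ⊢
    calc _ ≤ _ := h1
      _ ≤ _ := Nat.mul_le_mul_right _ h2
      _ = _ := by rw [mul_assoc, Nat.succ_sub_one, ← pow_succ]; rfl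

open scoped Classical in
-- Sum the preceding bound over all `y`. For a given `f`, the solutions `y` differ by elements of
-- the radical, and they exist only if the rank is even.
theorem sum_even_rank_ge [Fintype M] (hs : M ≤ symm K V) (hV : 0 < finrank K V) :
    Nat.card M ≤ ∑ f : M, if Even (rank f.1) then Nat.card (radL f.1) else 0 := by
  have : Finite V := Module.finite_of_finite K
  have : Fintype V := Fintype.ofFinite V
  have h := sum_natCard_comm
    (fun (f : M) (y : V) => f.1 y y = 0 ∧ f.1 y = sqrtDiag ⟨f.1, hs f.2⟩)
  have h1 : ∑ y : V, Nat.card M ≤ (∑ y : V,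
      Nat.card {f : M // f.1 y y = 0 ∧ f.1 y = sqrtDiag ⟨f.1, hs f.2⟩}) *
      Nat.card K ^ finrank K V := by
    rw [Finset.sum_mul]
    exact Finset.sum_le_sum fun y _ => natCard_le_natCard_apply_eq_sqrtDiag_mul hs hV y
  rw [← h, Finset.sum_const, smul_eq_mul, mul_comm, Finset.card_univ, ← Nat.card_eq_fintype_card,
    Module.natCard_eq_pow_finrank (K := K) (V := V)] at h1
  refine (Nat.le_of_mul_le_mul_right h1 (pow_pos Nat.card_pos _)).trans ?_
  refine Finset.sum_le_sum fun f _ => ?_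
  rcases isEmpty_or_nonempty {y : V // f.1 y y = 0 ∧ f.1 y = sqrtDiag ⟨f.1, hs f.2⟩} with he | ⟨⟨y⟩⟩
  · rw [Nat.card_of_isEmpty]
    exact Nat.zero_le _
  · rw [if_pos (even_rank_of_apply_eq_sqrtDiag ⟨f.1, hs f.2⟩ y.2.1 y.2.2)]
    refine Nat.card_le_card_of_injective (fun z => ⟨z.1 - y.1, ?_⟩) fun a b hab => ?_
    · change f.1 (z.1 - y.1) = 0
      rw [map_sub, z.2.2, y.2.2, sub_self]
    · exact Subtype.ext (sub_left_injective (Subtype.mk.inj hab))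

end

end FormSpace

namespace FormSpace

open Module

variable {K V : Type*} [Field K] [Finite K] [AddCommGroup V] [Module K V] [FiniteDimensional K V]

omit [Finite K] in
theorem natCard_eq_pow (M : Submodule K (LinearMap.BilinForm K V)) :
    Nat.card M = Nat.card K ^ finrank K M := Module.natCard_eq_pow_finrank

/-! ### The alternating part -/

section Alternating

variable {A : Submodule K (LinearMap.BilinForm K V)}

open scoped Classical in
/-- A space of at least `|V|` forms with one-dimensional radicals such that `f u u = 0` for every
vector `u` has exactly `|V|` elements, and each non-zero vector is in the radical of the
elements of a line. -/
theorem natCard_eq_of_finrank_radL_eq_one (hA : ∀ f ∈ A, f.IsAlt) (hV : 2 ≤ finrank K V)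
    (hrad : ∀ f ∈ A, f ≠ 0 → finrank K (radL f) = 1)
    (hcard : Nat.card K ^ finrank K V ≤ Nat.card A) :
    Nat.card A = Nat.card K ^ finrank K V ∧
      ∀ u : V, u ≠ 0 → Nat.card ↥(A ⊓ radAt K u) = Nat.card K := by
  have : Finite V := Module.finite_of_finite K
  have : Finite (LinearMap.BilinForm K V) := Module.finite_of_finite K
  have : Fintype V := Fintype.ofFinite V
  have : Fintype A := Fintype.ofFinite A
  have hq : 1 < Nat.card K := Finite.one_lt_card
  obtain ⟨m, hm⟩ : ∃ m, finrank K V = m + 1 + 1 := ⟨finrank K V - 2, by omega⟩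
  have hle : finrank K V ≤ finrank K A := by
    rw [natCard_eq_pow] at hcard
    exact (Nat.pow_le_pow_iff_right hq).1 hcard
  obtain ⟨k, hk⟩ := Nat.exists_eq_add_of_le hle
  have hAc : Nat.card A = Nat.card K ^ finrank K V * Nat.card K ^ k := by
    rw [natCard_eq_pow, hk, pow_add]
  have hVc : Nat.card V = Nat.card K ^ finrank K V := Module.natCard_eq_pow_finrank
  have hu : ∀ u ∈ Finset.univ.erase (0 : V),
      Nat.card K * Nat.card K ^ k ≤ Nat.card ↥(A ⊓ radAt K u) := by
    intro u hu
    have h := natCard_le_natCard_inf_radAt_mul_of_forall (M := A) (Finset.ne_of_mem_erase hu)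
      (w := u) fun f hf => hA f hf u
    rw [hAc, hm, Nat.add_sub_cancel, pow_succ, mul_assoc, mul_comm] at h
    exact Nat.le_of_mul_le_mul_right h (pow_pos (by omega) _)
  have hsum := sum_natCard_radL A
  have hleft : ∑ f ∈ Finset.univ.erase (0 : A), Nat.card (radL f.1) =
      (Nat.card A - 1) * Nat.card K := by
    rw [Finset.sum_congr rfl (g := fun _ => Nat.card K), Finset.sum_const,
      Finset.card_erase_of_mem (Finset.mem_univ _), Finset.card_univ, ← Nat.card_eq_fintype_card,
      smul_eq_mul]
    intro f hf
    rw [Module.natCard_eq_pow_finrank (K := K), hrad f f.2 fun h =>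
      Finset.ne_of_mem_erase hf (Subtype.ext h), pow_one]
  have hright := Finset.sum_le_sum hu
  have hconst : ∀ c : ℕ, ∑ _u ∈ Finset.univ.erase (0 : V), c = (Nat.card V - 1) * c := fun c => by
    rw [Finset.sum_const, Finset.card_erase_of_mem (Finset.mem_univ _), Finset.card_univ,
      ← Nat.card_eq_fintype_card, smul_eq_mul]
  rw [hconst] at hright
  rw [hleft] at hsum
  have hxq : Nat.card K < Nat.card K ^ finrank K V := by
    rw [hm]
    exact lt_self_pow₀ hq (by omega)
  have hy0 : 1 ≤ Nat.card K ^ k := Nat.one_le_pow _ _ (by omega)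
  rw [hVc] at hsum hright
  rw [hAc] at hsum
  -- With `x = q ^ n` and `y = q ^ k`, the double count reduces to `(x - q) * (y - 1) ≤ 0`, while `x
  -- > q`.
  have hy : Nat.card K ^ k = 1 := by
    generalize Nat.card K ^ k = y at *
    generalize Nat.card K ^ finrank K V = x at *
    generalize Nat.card K = q at *
    have hxy : 1 ≤ x * y := Nat.mul_pos (by omega) hy0
    by_contra hne
    have hy2 : 2 ≤ y := by omega
    have hx1 : 1 ≤ x := by omega
    zify [hxy, hx1] at *
    nlinarith
  rw [hy, mul_one] at hAc
  refine ⟨hAc, fun u hu0 => ?_⟩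
  rw [hy, mul_one] at hu hsum hright
  have heq : ∑ u ∈ Finset.univ.erase (0 : V), Nat.card K =
      ∑ u ∈ Finset.univ.erase (0 : V), Nat.card ↥(A ⊓ radAt K u) := by
    rw [hconst, hVc]
    omega
  exact ((Finset.sum_eq_sum_iff_of_le hu).1 heq u
    (Finset.mem_erase.2 ⟨hu0, Finset.mem_univ u⟩)).symm

end Alternating

/-! ### Forms with two prescribed radical vectors -/

section AlmostFullRank

/-- At the extreme values of `A` and `B`, `S` collapses to `(q - 1) * (x - 1) * (x - q)`, giving
equality. -/
theorem pairs_count_le {q x S : ℕ} {y A B : ℤ} (hq : 1 < q) (hxq : q ≤ x) (hy : (x : ℤ) = y)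
    (hA : A ≤ (y - 1) ^ 2) (hB : y ^ 2 - y ≤ B)
    (hS : (S : ℤ) = q * (q - 1) * A - (q - 1) ^ 2 * B) :
    (x - 1) * (x - q) + S ≤ (x - 1) * (x - q) * q := by
  subst hy
  have hq' : (1 : ℤ) < q := by exact_mod_cast hq
  zify [hxq, hq.le.trans hxq]
  have ha := mul_le_mul_of_nonneg_left hA (by nlinarith : (0 : ℤ) ≤ q * (q - 1))
  have hb := mul_le_mul_of_nonneg_left hB (sq_nonneg ((q : ℤ) - 1))
  linarith

variable [CharP K 2] {M : Submodule K (LinearMap.BilinForm K V)}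

omit [Finite K] [CharP K 2] in
theorem rank_eq_of_mem_altPart (hodd : Odd (finrank K V))
    (hrank : ∀ f ∈ M, f ≠ 0 → finrank K V - 2 ≤ rank f) :
    ∀ f ∈ altPart M, f ≠ 0 → rank f = finrank K V - 1 := by
  intro f hf hf0
  have h1 := hrank f hf.1 hf0
  have h2 := Nat.even_iff.1 (even_rank_of_isAlt hf.2)
  have h3 := rank_add_finrank_radL f
  have h4 := Nat.odd_iff.1 hodd
  omega

theorem natCard_altPart (hV : 3 ≤ finrank K V) (hodd : Odd (finrank K V)) (hs : M ≤ symm K V)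
    (hM : finrank K M = 2 * finrank K V)
    (hrank : ∀ f ∈ M, f ≠ 0 → finrank K V - 2 ≤ rank f) :
    Nat.card (altPart M) = Nat.card K ^ finrank K V ∧
      ∀ u : V, u ≠ 0 → Nat.card ↥(altPart M ⊓ radAt K u) = Nat.card K := by
  refine natCard_eq_of_finrank_radL_eq_one (fun f hf => hf.2) (by omega) (fun f hf hf0 => ?_) ?_
  · have h1 := rank_eq_of_mem_altPart hodd hrank f hf hf0
    have h2 := rank_add_finrank_radL f
    omega
  · have h := natCard_le_natCard_altPart_mul hs
    rw [natCard_eq_pow, hM, two_mul, pow_add] at h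
    exact Nat.le_of_mul_le_mul_right h (pow_pos Nat.card_pos _)

omit [CharP K 2] in
-- Having `u` in the radical costs at most `n` dimensions. By symmetry `f w` then kills `u`, so `w`
-- costs at most `n - 1`, leaving `2n - n - (n - 1) = 1`.
theorem natCard_le_natCard_inf_radAt_pair (hM : finrank K M = 2 * finrank K V) {u : V}
    (hu : u ≠ 0) (hs : M ≤ symm K V) (w : V) :
    Nat.card K ≤ Nat.card ↥(M ⊓ radAt K u ⊓ radAt K w) := by
  have hV : 0 < finrank K V := finrank_pos_iff_exists_ne_zero.2 ⟨u, hu⟩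
  have h1 := natCard_le_natCard_inf_radAt_mul (M := M) u
  have h2 := natCard_le_natCard_inf_radAt_mul_of_forall (M := M ⊓ radAt K u) hu (w := w)
    fun f hf => by
      rw [show f w u = f u w from (hs hf.1).eq w u]
      exact apply_eq_zero_of_mem_radAt hf.2 w
  rw [natCard_eq_pow M, hM, two_mul, pow_add] at h1
  have h3 := (Nat.le_of_mul_le_mul_right h1 (pow_pos Nat.card_pos _)).trans h2
  obtain ⟨m, hm⟩ := Nat.exists_eq_succ_of_ne_zero hV.ne'
  rw [hm, Nat.succ_sub_one, Nat.succ_eq_add_one, pow_succ, mul_comm] at h3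
  exact Nat.le_of_mul_le_mul_right h3 (pow_pos Nat.card_pos _)

open scoped Classical in
/-- In a `2n`-dimensional space of symmetric forms of rank at least `n - 2`, with `n` odd, the forms
having two given independent vectors in the radical form a line. -/
theorem natCard_inf_radAt_pair (hV : 3 ≤ finrank K V) (hodd : Odd (finrank K V))
    (hs : M ≤ symm K V) (hM : finrank K M = 2 * finrank K V)
    (hrank : ∀ f ∈ M, f ≠ 0 → finrank K V - 2 ≤ rank f) (s : Fin 2 → V)
    (hli : LinearIndependent K s) :
    Nat.card ↥(M ⊓ radAt K (s 0) ⊓ radAt K (s 1)) = Nat.card K := by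
  have : Finite V := Module.finite_of_finite K
  have : Finite (LinearMap.BilinForm K V) := Module.finite_of_finite K
  have : Fintype V := Fintype.ofFinite V
  have : Fintype M := Fintype.ofFinite M
  have : Fintype {s : Fin 2 → V // LinearIndependent K s} := Fintype.ofFinite _
  have hq : 1 < Nat.card K := Finite.one_lt_card
  have hVc : Nat.card V = Nat.card K ^ finrank K V := Module.natCard_eq_pow_finrank
  have hMc : Nat.card M = Nat.card K ^ finrank K V * Nat.card K ^ finrank K V := by
    rw [natCard_eq_pow, hM, two_mul, pow_add]
  have hxq : Nat.card K ≤ Nat.card K ^ finrank K V := Nat.le_self_pow (by omega) _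
  have hcardE : ((Finset.univ.erase (0 : M)).card : ℤ) = (Nat.card M : ℤ) - 1 := by
    rw [Finset.card_erase_of_mem (Finset.mem_univ _), Finset.card_univ, ← Nat.card_eq_fintype_card,
      Nat.cast_sub Nat.card_pos, Nat.cast_one]
  -- first moment
  have hfirst : ∑ f ∈ Finset.univ.erase (0 : M), ((Nat.card (radL f.1) : ℤ) - 1) ≤
      ((Nat.card K : ℤ) ^ finrank K V - 1) ^ 2 := by
    have h1 : ∑ u ∈ Finset.univ.erase (0 : V), Nat.card ↥(M ⊓ radAt K u) ≤
        (Nat.card V - 1) * Nat.card K ^ finrank K V := by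
      rw [← Fintype.card_eq_nat_card, ← Finset.card_univ,
        ← Finset.card_erase_of_mem (Finset.mem_univ (0 : V)), ← smul_eq_mul]
      refine Finset.sum_le_card_nsmul _ _ _ fun u hu => ?_
      have hu0 := Finset.ne_of_mem_erase hu
      refine (natCard_inf_radAt_le hs hu0).trans ?_
      rw [(natCard_altPart hV hodd hs hM hrank).2 u hu0, ← pow_succ', Nat.sub_add_cancel (by omega)]
    have h2 := sum_natCard_radL M
    rw [hVc, hMc] at h2
    rw [hVc] at h1
    rw [Finset.sum_sub_distrib, Finset.sum_const, nsmul_eq_mul, hcardE, hMc]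
    zify [show 1 ≤ Nat.card K ^ finrank K V by omega] at h1 h2
    push_cast
    linarith
  -- forms of even rank
  have heven : ((Nat.card K : ℤ) ^ finrank K V) ^ 2 - (Nat.card K : ℤ) ^ finrank K V ≤
      ∑ f ∈ Finset.univ.erase (0 : M), if Even (rank f.1) then (Nat.card (radL f.1) : ℤ) else 0 := by
    have h := sum_even_rank_ge hs (by omega : 0 < finrank K V)
    rw [← Finset.add_sum_erase _ _ (Finset.mem_univ (0 : M))] at h
    have h0 : (if Even (rank (0 : M).1) then Nat.card (radL (0 : M).1) else 0) =
        Nat.card K ^ finrank K V := by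
      have : radL (0 : M).1 = (⊤ : Submodule K V) := radL_zero
      rw [this, rank, this, finrank_top, Nat.sub_self, if_pos Even.zero,
        Module.natCard_eq_pow_finrank (K := K), finrank_top]
    rw [h0, hMc] at h
    zify at h
    linarith
  -- The radical has size `t = 1`, `q` or `q ^ 2`, and as `n` is odd the rank is even exactly for `t
  -- = q`. The coefficients make the right side vanish at `t = q` and agree with the pair count at
  -- `t = q ^ 2`.
  have hpt : ∀ f ∈ Finset.univ.erase (0 : M),
      (((Nat.card (radL f.1) - 1) * (Nat.card (radL f.1) - Nat.card K) : ℕ) : ℤ) =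
      (Nat.card K : ℤ) * (Nat.card K - 1) * (Nat.card (radL f.1) - 1) -
        (Nat.card K - 1) ^ 2 * if Even (rank f.1) then (Nat.card (radL f.1) : ℤ) else 0 := by
    intro f hf
    have hf0 : f.1 ≠ 0 := fun h => Finset.ne_of_mem_erase hf (Subtype.ext h)
    have h1 := hrank f f.2 hf0
    have h2 := rank_add_finrank_radL f.1
    have h3 : finrank K (radL f.1) ≤ 2 := by omega
    have h4 := Nat.odd_iff.1 hodd
    have hq1 : 1 ≤ Nat.card K := hq.le
    rw [Module.natCard_eq_pow_finrank (K := K) (V := radL f.1)]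
    interval_cases hk : finrank K (radL f.1)
    · rw [if_neg (by rw [Nat.even_iff]; omega)]
      simp
    · rw [if_pos (by rw [Nat.even_iff]; omega)]
      simp
      ring
    · rw [if_neg (by rw [Nat.even_iff]; omega)]
      have h5 : 1 ≤ Nat.card K ^ 2 := Nat.one_le_pow _ _ (by omega)
      have h6 : Nat.card K ≤ Nat.card K ^ 2 := Nat.le_self_pow (by omega) _
      push_cast [h5, h6]
      ring
  have hpairs := sum_natCard_pairs M
  have hP : Nat.card {s : Fin 2 → V // LinearIndependent K s} =
      (Nat.card K ^ finrank K V - 1) * (Nat.card K ^ finrank K V - Nat.card K) := by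
    rw [← finrank_top K V, ← natCard_linearIndependent_pairs]
    exact (Nat.card_congr (Equiv.subtypeUnivEquiv fun s => by simp)).symm
  have hge : ∀ s ∈ (Finset.univ : Finset {s : Fin 2 → V // LinearIndependent K s}),
      Nat.card K ≤ Nat.card ↥(M ⊓ radAt K (s.1 0) ⊓ radAt K (s.1 1)) := fun s _ =>
    natCard_le_natCard_inf_radAt_pair hM (s.2.ne_zero 0) hs _
  -- Every term is at least `q` and the total is at most `q` per pair, so every term equals `q`.
  have heq : ∑ s : {s : Fin 2 → V // LinearIndependent K s}, Nat.card K =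
      ∑ s : {s : Fin 2 → V // LinearIndependent K s},
        Nat.card ↥(M ⊓ radAt K (s.1 0) ⊓ radAt K (s.1 1)) := by
    refine le_antisymm (Finset.sum_le_sum hge) ?_
    rw [← hpairs, Finset.sum_const, Finset.card_univ, ← Nat.card_eq_fintype_card, smul_eq_mul, hP]
    refine pairs_count_le hq hxq (Nat.cast_pow _ _) hfirst heven ?_
    rw [Nat.cast_sum, Finset.sum_congr rfl hpt, Finset.sum_sub_distrib, ← Finset.mul_sum,
      ← Finset.mul_sum]
  exact ((Finset.sum_eq_sum_iff_of_le hge).1 heq ⟨s, hli⟩ (Finset.mem_univ _)).symm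

end AlmostFullRank
end FormSpace

/-! ### Constant rank subspaces and the dimension bound -/

namespace FormSpace

open Module

variable {K V : Type*} [Field K] [Finite K] [AddCommGroup V] [Module K V] [FiniteDimensional K V]
  [CharP K 2] {N : Submodule K (LinearMap.BilinForm K V)}

/-- The common isotropic vectors of a space of symmetric forms in characteristic two. -/
noncomputable def isotropic (hs : N ≤ symm K V) : Submodule K V :=
  ⨅ f : N, LinearMap.ker (sqrtDiag ⟨f.1, hs f.2⟩)

omit [FiniteDimensional K V] in
theorem mem_isotropic (hs : N ≤ symm K V) {v : V} :
    v ∈ isotropic hs ↔ ∀ f ∈ N, f v v = 0 := by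
  simp [isotropic, Submodule.mem_iInf, sqrtDiag_apply_eq_zero_iff]

/-- `sqrtDiag` is injective on `N` and takes values in the annihilator of the isotropic space. -/
theorem finrank_add_finrank_isotropic_le (hs : N ≤ symm K V)
    (hN : ∀ f ∈ N, f ∈ alt K V → f = 0) :
    finrank K N + finrank K (isotropic hs) ≤ finrank K V := by
  have : Finite (Dual K V) := Module.finite_of_finite K
  have : Finite (LinearMap.BilinForm K V) := Module.finite_of_finite K
  have hq : 1 < Nat.card K := Finite.one_lt_card
  have h := natCard_le_mul_of_addMonoidHom
    (sqrtDiag.comp (Submodule.inclusion hs : N →+ symm K V))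
    ((isotropic hs).dualAnnihilator : Set (Dual K V))
    (fun f => (Submodule.mem_dualAnnihilator _).2 fun v hv =>
      (sqrtDiag_apply_eq_zero_iff _ v).2 ((mem_isotropic hs).1 hv f f.2))
    {(0 : LinearMap.BilinForm K V)} Subtype.val Subtype.val_injective
    fun x hx => hN x x.2 (mem_alt_of_sqrtDiag_eq_zero (f := ⟨x.1, hs x.2⟩) hx)
  have h2 := natCard_dualAnnihilator (isotropic hs)
  have h1 : Nat.card ({(0 : LinearMap.BilinForm K V)} : Set _) = 1 := by simp
  rw [h1, one_mul, natCard_eq_pow] at h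
  have h3 := Nat.mul_le_mul_right (Nat.card K ^ finrank K (isotropic hs)) h
  rw [SetLike.coe_sort_coe, h2, ← pow_add] at h3
  exact (Nat.pow_le_pow_iff_right hq).1 h3

omit [CharP K 2] in
open scoped Classical in
/-- If the radicals of the non-zero elements of `N` are planes in the subspace `U`, each plane
being the radical of at most one line of forms, then `N` has no more lines than `U` has planes. -/
theorem natCard_sub_one_mul_le (U : Submodule K V) (hU : ∀ f ∈ N, f ≠ 0 → radL f ≤ U)
    (hdim : ∀ f ∈ N, f ≠ 0 → finrank K (radL f) = 2)
    (hpair : ∀ s : Fin 2 → V, LinearIndependent K s →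
      Nat.card ↥(N ⊓ radAt K (s 0) ⊓ radAt K (s 1)) ≤ Nat.card K) :
    (Nat.card N - 1) * ((Nat.card K ^ 2 - 1) * (Nat.card K ^ 2 - Nat.card K)) ≤
      (Nat.card K - 1) * ((Nat.card K ^ finrank K U - 1) *
        (Nat.card K ^ finrank K U - Nat.card K)) := by
  have : Finite V := Module.finite_of_finite K
  have : Finite (LinearMap.BilinForm K V) := Module.finite_of_finite K
  have : Fintype N := Fintype.ofFinite N
  have : Fintype {s : Fin 2 → V // LinearIndependent K s} := Fintype.ofFinite _
  have hq : 1 < Nat.card K := Finite.one_lt_card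
  have h := sum_natCard_pairs N
  have hleft : ∑ f ∈ Finset.univ.erase (0 : N),
      (Nat.card (radL f.1) - 1) * (Nat.card (radL f.1) - Nat.card K) =
      (Nat.card N - 1) * ((Nat.card K ^ 2 - 1) * (Nat.card K ^ 2 - Nat.card K)) := by
    rw [Finset.sum_congr rfl (g := fun _ => (Nat.card K ^ 2 - 1) * (Nat.card K ^ 2 - Nat.card K)),
      Finset.sum_const, Finset.card_erase_of_mem (Finset.mem_univ _), Finset.card_univ,
      ← Nat.card_eq_fintype_card, smul_eq_mul]
    intro f hf
    rw [Module.natCard_eq_pow_finrank (K := K) (V := radL f.1), hdim f f.2 fun h =>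
      Finset.ne_of_mem_erase hf (Subtype.ext h)]
  have hright : ∑ s : {s : Fin 2 → V // LinearIndependent K s},
      Nat.card ↥(N ⊓ radAt K (s.1 0) ⊓ radAt K (s.1 1)) ≤
      ∑ s : {s : Fin 2 → V // LinearIndependent K s},
        -- The zero form contributes 1 for every pair; non-zero forms contribute only for pairs
        -- inside `U`.
        (1 + if ∀ i, s.1 i ∈ U then Nat.card K - 1 else 0) := by
    refine Finset.sum_le_sum fun s _ => ?_
    split_ifs with hs
    · have := hpair s.1 s.2
      omega
    · have hbot : N ⊓ radAt K (s.1 0) ⊓ radAt K (s.1 1) = ⊥ := by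
        rw [Submodule.eq_bot_iff]
        intro f hf
        by_contra hf0
        exact hs (Fin.forall_fin_two.2 ⟨hU f hf.1.1 hf0 hf.1.2, hU f hf.1.1 hf0 hf.2⟩)
      rw [hbot, natCard_eq_pow, finrank_bot, pow_zero, add_zero]
  rw [Finset.sum_add_distrib, ← Finset.sum_filter, Finset.sum_const, Finset.sum_const,
    Finset.card_univ, ← Nat.card_eq_fintype_card, smul_eq_mul, smul_eq_mul, mul_one,
    ← Fintype.card_subtype, ← Nat.card_eq_fintype_card, natCard_linearIndependent_pairs] at hright
  rw [hleft] at h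
  rw [mul_comm (Nat.card K - 1)]
  omega

/-- If the bound fails then `2k ≤ d + 2`. But `d`-space then has at least about `q ^ (2k - 3)`
lines, whereas `k`-space has only about `q ^ (2k - 4)` planes. -/
theorem three_mul_add_three_le {q d k n : ℕ} (hq : 1 < q) (hd : 0 < d) (hdk : d + k ≤ n)
    (h : (q ^ d - 1) * ((q ^ 2 - 1) * (q ^ 2 - q)) ≤ (q - 1) * ((q ^ k - 1) * (q ^ k - q))) :
    3 * d + 3 ≤ 2 * n := by
  by_contra hcon
  have hdk2 : 2 * k ≤ d + 2 := by omega
  have hX : 1 < q ^ d := Nat.one_lt_pow hd.ne' hq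
  have hq2 : q < q ^ 2 := lt_self_pow₀ hq (by omega)
  have hpos : 0 < (q - 1) * ((q ^ k - 1) * (q ^ k - q)) :=
    lt_of_lt_of_le (Nat.mul_pos (by omega) (Nat.mul_pos (by omega) (by omega))) h
  have hYq : q < q ^ k := by
    by_contra hle
    rw [Nat.sub_eq_zero_of_le (not_lt.1 hle)] at hpos
    simp at hpos
  have hk : 2 ≤ k := by
    have : q ^ 1 < q ^ k := by simpa using hYq
    exact (Nat.pow_lt_pow_iff_right hq).1 this
  have hY : q ^ 2 ≤ q ^ k := Nat.pow_le_pow_right (by omega) hk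
  have hXY : q ^ k * q ^ k ≤ q ^ 2 * q ^ d := by
    rw [← pow_add, ← pow_add]
    exact Nat.pow_le_pow_right (by omega) (by omega)
  clear hpos
  generalize q ^ d = X at *
  generalize q ^ k = Y at *
  zify [hq.le, hX.le, hq2.le, hYq.le, hq.le.trans hq2.le, hq.le.trans hYq.le] at *
  have h1 : (X - 1 : ℤ) * ((q ^ 2 - 1) * q) ≤ (Y - 1) * (Y - q) := by
    refine le_of_mul_le_mul_left ?_ (by linarith : (0 : ℤ) < q - 1)
    linarith
  have h2 : ((Y : ℤ) * Y - q ^ 2) * ((q ^ 2 - 1) * q) ≤ q ^ 2 * ((Y - 1) * (Y - q)) := by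
    have h3 : (0 : ℤ) ≤ (q ^ 2 - 1) * q := mul_nonneg (by linarith) (by linarith)
    have h4 := mul_le_mul_of_nonneg_right hXY h3
    have h5 := mul_le_mul_of_nonneg_left h1 (sq_nonneg (q : ℤ))
    linarith
  have h6 : ((Y : ℤ) * Y - q ^ 2) * (q ^ 2 - 1) ≤ q * ((Y - 1) * (Y - q)) := by
    refine le_of_mul_le_mul_left ?_ (by linarith : (0 : ℤ) < q)
    linarith
  have h7 : (0 : ℤ) < q ^ 2 - q - 1 := by nlinarith
  have h8 : (q : ℤ) ^ 2 * q ^ 2 ≤ Y * Y := mul_le_mul hY hY (by positivity) (by linarith)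
  have h9 := mul_le_mul_of_nonneg_left h8 (show (0 : ℤ) ≤ q ^ 2 - q - 1 by linarith)
  have h10 := mul_le_mul_of_nonneg_left hY (show (0 : ℤ) ≤ q * (q + 1) by nlinarith)
  have h11 : (0 : ℤ) < q ^ 3 * (q + 1) := by positivity
  have h12 : (q : ℤ) ^ 2 * q ^ 2 * 1 ≤ q ^ 2 * q ^ 2 * (q ^ 2 - q - 1) :=
    mul_le_mul_of_nonneg_left (by linarith) (by positivity)
  nlinarith

end FormSpace

open Module in
theorem mainTheorem9 {K V : Type*} [Field K] [Finite K]
    [AddCommGroup V] [Module K V] [FiniteDimensional K V]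
    (n q : ℕ) (hn : 3 ≤ n) (hodd : Odd n) (hdim : Module.finrank K V = n)
    (hcard : Nat.card K = q) (hq : ∃ k : ℕ, q = 2 ^ k)
    (M : Submodule K (LinearMap.BilinForm K V)) (hsymm : M ≤ FormSpace.symm K V)
    (hM : Module.finrank K M = 2 * n)
    (hrank : ∀ f ∈ M, f ≠ 0 → n - 2 ≤ FormSpace.rank f) :
    (Module.finrank K (FormSpace.altPart M) = n ∧
      FormSpace.IsConstantRank (FormSpace.altPart M) (n - 1)) ∧
    (n - 1 ≤ q → ∀ N : Submodule K (LinearMap.BilinForm K V), N ≤ M →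
      FormSpace.IsConstantRank N (n - 2) →
        (Module.finrank K N : ℚ) ≤ (2 * (n : ℚ) - 3) / 3) := by
  subst hdim hcard
  have : CharP K 2 := by
    obtain ⟨k, hk⟩ := hq
    have := Fintype.ofFinite K
    exact charP_of_card_eq_prime_pow (f := k) (by rw [← Nat.card_eq_fintype_card, hk])
  have hK : 1 < Nat.card K := Finite.one_lt_card
  refine ⟨?_, fun hqn N hNM hN => ?_⟩
  · have hA := (FormSpace.natCard_altPart hn hodd hsymm hM hrank).1
    rw [FormSpace.natCard_eq_pow] at hA
    have hA' := Nat.pow_right_injective hK hA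
    refine ⟨hA', fun hbot => ?_, by omega, by omega,
      FormSpace.rank_eq_of_mem_altPart hodd hrank⟩
    rw [hbot, finrank_bot] at hA'
    omega
  · have hNs := hNM.trans hsymm
    have hdim : ∀ f ∈ N, f ≠ 0 → finrank K (FormSpace.radL f) = 2 := fun f hf hf0 => by
      have h1 := hN.rank_eq f hf hf0
      have h2 := FormSpace.rank_add_finrank_radL f
      omega
    have hNalt : ∀ f ∈ N, f ∈ FormSpace.alt K V → f = 0 := fun f hf hfa => by
      by_contra hf0
      have h1 := Nat.even_iff.1 (FormSpace.even_rank_of_isAlt hfa)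
      rw [hN.rank_eq f hf hf0] at h1
      have h2 := Nat.odd_iff.1 hodd
      omega
    -- The assumption `n - 1 ≤ q` enters here, as `n - 2 < q` in the eigenvalue argument.
    have h := FormSpace.natCard_sub_one_mul_le (FormSpace.isotropic hNs)
      (fun f hf hf0 u hu => (FormSpace.mem_isotropic hNs).2 fun g hg =>
        FormSpace.apply_self_eq_zero_of_mem_radL hNs hN.rank_eq (by omega) hf hf0 hg hu) hdim
      fun s hs => by
        have : Finite (LinearMap.BilinForm K V) := Module.finite_of_finite K
        rw [← FormSpace.natCard_inf_radAt_pair hn hodd hsymm hM hrank s hs]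
        exact Nat.card_mono (Set.toFinite _)
          (inf_le_inf_right _ (inf_le_inf_right _ hNM))
    rw [FormSpace.natCard_eq_pow] at h
    have hd : 0 < finrank K N := by
      have : Nontrivial N := Submodule.nontrivial_iff_ne_bot.2 hN.ne_bot
      exact finrank_pos
    have hfin := FormSpace.three_mul_add_three_le hK hd
      (FormSpace.finrank_add_finrank_isotropic_le hNs hNalt) h
    have hfin' : (3 * finrank K N + 3 : ℚ) ≤ 2 * finrank K V := by exact_mod_cast hfin
    linarith
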